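/- **Proposition.** An $F$-inverse monoid is an inverse monoid in which every class of the minimum group congruence $\sigma$ has a greatest element in the natural partial order; it is regarded as an algebra in the signature $(\cdot,1,{}^{-1},{}^{\mathfrak m})$, where $a^{\mathfrak m}$ is the greatest element of the $\sigma$-class of $a$. In this signature $F$-inverse monoids form a variety. For a set $Y$ and a set $R$ of pairs of terms over $Y$ in this signature, $\operatorname{FInv}\langle Y\mid R\rangle$ denotes the quotient of the free $F$-inverse monoid on $Y$ by the congruence generated by $R$; an $F$-inverse monoid is finitely presented if it is isomorphic to some $\operatorname{FInv}\langle Y\mid R\rangle$ with $Y$ and $R$ finite. Let $X$ be a nonempty set, and let $\operatorname{FIM}(X)$ be the free inverse monoid on $X$, regarded as an $F$-inverse monoid, with $(w_{\operatorname{FIM}(X)})^{\mathfrak m}=(\operatorname{red}(w))_{\operatorname{FIM}(X)}$ for every word $w\in(X\cup X^{-1})^*$, where $\operatorname{red}(w)$ is the freely reduced form of $w$ and $w_{\operatorname{FIM}(X)}$ is the element represented by $w$. Then $\operatorname{FIM}(X)$ is not finitely presented as an $F$-inverse monoid. -/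

import Mathlib

/-- An inverse monoid: a monoid in which every element `a` has a unique inverse `a⁻¹`,
i.e. a unique `b` with `a b a = a` and `b a b = b`. -/
class InverseMonoid (S : Type*) extends Monoid S, Inv S where
  mul_inv_mul : ∀ a : S, a * a⁻¹ * a = a
  inv_mul_inv : ∀ a : S, a⁻¹ * a * a⁻¹ = a⁻¹
  inv_unique : ∀ a b : S, a * b * a = a → b * a * b = b → b = a⁻¹

namespace InverseMonoid

/-- The natural partial order: `a ≤ b` iff `a = e b` for some idempotent `e`. -/
def NatLE {S : Type*} [InverseMonoid S] (a b : S) : Prop :=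
  ∃ e : S, IsIdempotentElem e ∧ a = e * b

/-- The minimum group congruence `σ`: two elements are related iff they have a common lower
bound in the natural partial order. -/
def Sigma {S : Type*} [InverseMonoid S] (a b : S) : Prop :=
  ∃ c : S, NatLE c a ∧ NatLE c b

section Equational

variable {S : Type*} [Monoid S] [Inv S]

/-- Consequence of the equational axioms for inverse monoids: idempotents are self-inverse. -/
theorem idem_eq_inv
    (h1 : ∀ a : S, a⁻¹⁻¹ = a) (h2 : ∀ a b : S, (a * b)⁻¹ = b⁻¹ * a⁻¹)
    (h3 : ∀ a : S, a * a⁻¹ * a = a)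
    (h4 : ∀ a b : S, (a * a⁻¹) * (b * b⁻¹) = (b * b⁻¹) * (a * a⁻¹))
    (e : S) (he : e * e = e) : e⁻¹ = e := by
  have h5 : e⁻¹ * e⁻¹ = e⁻¹ := by rw [← h2, he]
  have h6 : e⁻¹ * e * e⁻¹ = e⁻¹ := by
    have := h3 e⁻¹
    rwa [h1] at this
  have h7 := h4 e⁻¹ e
  rw [h1] at h7
  calc e⁻¹ = e⁻¹ * (e * e) * e⁻¹ := by rw [he, h6]
    _ = e⁻¹ * e * (e * e⁻¹) := by simp only [mul_assoc]
    _ = e * e⁻¹ * (e⁻¹ * e) := h7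
    _ = e * (e⁻¹ * e⁻¹) * e := by simp only [mul_assoc]
    _ = e := by rw [h5, h3]

/-- The equational axioms for inverse monoids imply that inverses are unique. -/
theorem unique_of_equations
    (h1 : ∀ a : S, a⁻¹⁻¹ = a) (h2 : ∀ a b : S, (a * b)⁻¹ = b⁻¹ * a⁻¹)
    (h3 : ∀ a : S, a * a⁻¹ * a = a)
    (h4 : ∀ a b : S, (a * a⁻¹) * (b * b⁻¹) = (b * b⁻¹) * (a * a⁻¹))
    (a b : S) (hab : a * b * a = a) (hba : b * a * b = b) : b = a⁻¹ := by
  have hcomm : ∀ e f : S, e * e = e → f * f = f → e * f = f * e := by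
    intro e f he hf
    have := h4 e f
    rwa [idem_eq_inv h1 h2 h3 h4 e he, idem_eq_inv h1 h2 h3 h4 f hf, he, hf] at this
  have h6 : a⁻¹ * a * a⁻¹ = a⁻¹ := by
    have := h3 a⁻¹
    rwa [h1] at this
  have i1 : (a * a⁻¹) * (a * a⁻¹) = a * a⁻¹ := by rw [← mul_assoc, h3]
  have i2 : (a⁻¹ * a) * (a⁻¹ * a) = a⁻¹ * a := by rw [← mul_assoc, h6]
  have i3 : (a * b) * (a * b) = a * b := by rw [← mul_assoc, hab]
  have i4 : (b * a) * (b * a) = b * a := by rw [← mul_assoc, hba]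
  calc b = b * (a * a⁻¹ * a) * b := by rw [h3, hba]
    _ = b * ((a * a⁻¹) * (a * b)) := by simp only [mul_assoc]
    _ = b * ((a * b) * (a * a⁻¹)) := by rw [hcomm _ _ i1 i3]
    _ = b * (a * b * a) * a⁻¹ := by simp only [mul_assoc]
    _ = b * a * (a⁻¹ * a * a⁻¹) := by rw [hab, h6]
    _ = ((b * a) * (a⁻¹ * a)) * a⁻¹ := by simp only [mul_assoc]
    _ = ((a⁻¹ * a) * (b * a)) * a⁻¹ := by rw [hcomm _ _ i4 i2]
    _ = a⁻¹ * (a * b * a) * a⁻¹ := by simp only [mul_assoc]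
    _ = a⁻¹ := by rw [hab, h6]

end Equational

section Lemmas

variable {S : Type*} [InverseMonoid S]

theorem idem_inv {e : S} (he : IsIdempotentElem e) : e⁻¹ = e :=
  (inv_unique e e (by rw [he.eq, he.eq]) (by rw [he.eq, he.eq])).symm

theorem mul_inv_idem (a : S) : IsIdempotentElem (a * a⁻¹) := by
  unfold IsIdempotentElem; rw [← mul_assoc, mul_inv_mul]

theorem inv_mul_idem (a : S) : IsIdempotentElem (a⁻¹ * a) := by
  unfold IsIdempotentElem; rw [← mul_assoc, inv_mul_inv]

theorem double_inv (a : S) : a⁻¹⁻¹ = a :=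
  (inv_unique a⁻¹ a (inv_mul_inv a) (mul_inv_mul a)).symm

/-- A product of two idempotents is an idempotent. -/
theorem idem_mul {e f : S} (he : IsIdempotentElem e) (hf : IsIdempotentElem f) :
    IsIdempotentElem (e * f) := by
  have he' : ∀ z : S, e * (e * z) = e * z := fun z => by rw [← mul_assoc, he.eq]
  have hf' : ∀ z : S, f * (f * z) = f * z := fun z => by rw [← mul_assoc, hf.eq]
  have hx1 := mul_inv_mul (e * f)
  have hx2 := inv_mul_inv (e * f)
  generalize hx : (e * f)⁻¹ = x at hx1 hx2
  have hx3 : f * x * e = x := by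
    rw [← hx]
    refine inv_unique _ _ ?_ ?_
    · rw [hx]
      simp only [mul_assoc] at hx1 ⊢
      rw [hf', he', hx1]
    · rw [hx]
      simp only [mul_assoc] at hx2 ⊢
      rw [he', hf']
      conv_rhs => rw [← hx2]
      simp only [mul_assoc]
  have hxi : IsIdempotentElem x := by
    unfold IsIdempotentElem
    calc x * x = (f * x * e) * (f * x * e) := by rw [hx3]
      _ = f * (x * (e * f) * x) * e := by simp only [mul_assoc]
      _ = x := by rw [hx2, hx3]
  have : e * f = x := by
    rw [← idem_inv hxi, ← hx, double_inv]
  rw [this]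
  exact hxi

/-- Idempotents of an inverse monoid commute. -/
theorem idem_comm {e f : S} (he : IsIdempotentElem e) (hf : IsIdempotentElem f) :
    e * f = f * e := by
  have hef := idem_mul he hf
  have hfe := idem_mul hf he
  have he' : ∀ z : S, e * (e * z) = e * z := fun z => by rw [← mul_assoc, he.eq]
  have hf' : ∀ z : S, f * (f * z) = f * z := fun z => by rw [← mul_assoc, hf.eq]
  have : f * e = (e * f)⁻¹ := by
    refine inv_unique _ _ ?_ ?_
    · have := hef.eq
      simp only [mul_assoc] at this ⊢
      rw [hf', he', this]
    · have := hfe.eq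
      simp only [mul_assoc] at this ⊢
      rw [he', hf', this]
  rw [this, idem_inv hef]

theorem mul_inv_rev' (a b : S) : (a * b)⁻¹ = b⁻¹ * a⁻¹ := by
  have h := idem_comm (mul_inv_idem b) (inv_mul_idem a)
  refine (inv_unique _ _ ?_ ?_).symm
  · calc a * b * (b⁻¹ * a⁻¹) * (a * b) = a * ((b * b⁻¹) * (a⁻¹ * a)) * b := by
          simp only [mul_assoc]
      _ = (a * a⁻¹ * a) * (b * b⁻¹ * b) := by rw [h]; simp only [mul_assoc]
      _ = a * b := by rw [mul_inv_mul, mul_inv_mul]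
  · calc b⁻¹ * a⁻¹ * (a * b) * (b⁻¹ * a⁻¹) = b⁻¹ * ((a⁻¹ * a) * (b * b⁻¹)) * a⁻¹ := by
          simp only [mul_assoc]
      _ = (b⁻¹ * b * b⁻¹) * (a⁻¹ * a * a⁻¹) := by rw [← h]; simp only [mul_assoc]
      _ = b⁻¹ * a⁻¹ := by rw [inv_mul_inv, inv_mul_inv]

theorem NatLE.refl (a : S) : NatLE a a := ⟨1, mul_one 1, (one_mul a).symm⟩

theorem NatLE.trans {a b c : S} (hab : NatLE a b) (hbc : NatLE b c) : NatLE a c := by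
  obtain ⟨e, he, rfl⟩ := hab
  obtain ⟨f, hf, rfl⟩ := hbc
  exact ⟨e * f, idem_mul he hf, (mul_assoc _ _ _).symm⟩

theorem NatLE.eq_mul {a b : S} (h : NatLE a b) : a = a * a⁻¹ * b := by
  obtain ⟨e, he, rfl⟩ := h
  have h' := idem_comm he (mul_inv_idem b)
  rw [mul_inv_rev', idem_inv he]
  calc e * b = e * e * (b * b⁻¹ * b) := by rw [he.eq, mul_inv_mul]
    _ = e * (e * (b * b⁻¹)) * b := by simp only [mul_assoc]
    _ = e * b * (b⁻¹ * e) * b := by rw [h']; simp only [mul_assoc]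

theorem NatLE.antisymm {a b : S} (hab : NatLE a b) (hba : NatLE b a) : a = b := by
  have h1 := hab.eq_mul
  have h2 := hba.eq_mul
  calc a = a * a⁻¹ * (b * b⁻¹ * a) := by rw [← h2, ← h1]
    _ = (a * a⁻¹ * (b * b⁻¹)) * a := by simp only [mul_assoc]
    _ = b * b⁻¹ * (a * a⁻¹ * a) := by
      rw [idem_comm (mul_inv_idem a) (mul_inv_idem b)]; simp only [mul_assoc]
    _ = b := by rw [mul_inv_mul, ← h2]

theorem natLE_insert_idem (u v : S) {e : S} (he : IsIdempotentElem e) :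
    NatLE (u * e * v) (u * v) := by
  have h := idem_comm he (inv_mul_idem u)
  have key : u * e * u⁻¹ * u = u * e := by
    calc u * e * u⁻¹ * u = u * (e * (u⁻¹ * u)) := by simp only [mul_assoc]
      _ = (u * u⁻¹ * u) * e := by rw [h]; simp only [mul_assoc]
      _ = u * e := by rw [mul_inv_mul]
  refine ⟨u * e * u⁻¹, ?_, ?_⟩
  · unfold IsIdempotentElem
    calc u * e * u⁻¹ * (u * e * u⁻¹) = (u * e * u⁻¹ * u) * e * u⁻¹ := by simp only [mul_assoc]
      _ = u * (e * e) * u⁻¹ := by rw [key]; simp only [mul_assoc]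
      _ = u * e * u⁻¹ := by rw [he.eq]
  · rw [← mul_assoc, key]

end Lemmas

end InverseMonoid

/-- An `F`-inverse monoid in the signature `(·, 1, ⁻¹, ᵐ)`: an inverse monoid in which every
`σ`-class has a greatest element in the natural partial order; `maxOf a` (written `aᵐ` on paper)
is the greatest element of the `σ`-class of `a`. -/
class FInverseMonoid (S : Type*) extends InverseMonoid S where
  maxOf : S → S
  sigma_maxOf : ∀ a : S, InverseMonoid.Sigma a (maxOf a)
  le_maxOf : ∀ a b : S, InverseMonoid.Sigma a b → InverseMonoid.NatLE b (maxOf a)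

/-- Terms over `Y` in the signature `(·, 1, ⁻¹, ᵐ)`. -/
inductive FTerm (Y : Type*) : Type _
  | var : Y → FTerm Y
  | one : FTerm Y
  | mul : FTerm Y → FTerm Y → FTerm Y
  | inv : FTerm Y → FTerm Y
  | maxOf : FTerm Y → FTerm Y

namespace FTerm

/-- The value of a term in an `F`-inverse monoid under an assignment of the variables. -/
def eval {Y S : Type*} [FInverseMonoid S] (φ : Y → S) : FTerm Y → S
  | var y => φ y
  | one => 1
  | mul s t => eval φ s * eval φ t
  | inv t => (eval φ t)⁻¹
  | maxOf t => FInverseMonoid.maxOf (eval φ t)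

/-- The least congruence on the term algebra that contains `R` and all instances of the defining
identities of the variety of `F`-inverse monoids. -/
inductive Congr {Y : Type*} (R : Set (FTerm Y × FTerm Y)) : FTerm Y → FTerm Y → Prop
  | of {s t : FTerm Y} : (s, t) ∈ R → Congr R s t
  | refl (s : FTerm Y) : Congr R s s
  | symm {s t : FTerm Y} : Congr R s t → Congr R t s
  | trans {s t r : FTerm Y} : Congr R s t → Congr R t r → Congr R s r
  | mul_congr {s s' t t' : FTerm Y} :
      Congr R s s' → Congr R t t' → Congr R (mul s t) (mul s' t')
  | inv_congr {s s' : FTerm Y} : Congr R s s' → Congr R (inv s) (inv s')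
  | maxOf_congr {s s' : FTerm Y} : Congr R s s' → Congr R (maxOf s) (maxOf s')
  | mul_assoc (s t r : FTerm Y) : Congr R (mul (mul s t) r) (mul s (mul t r))
  | one_mul (s : FTerm Y) : Congr R (mul one s) s
  | mul_one (s : FTerm Y) : Congr R (mul s one) s
  | inv_inv (s : FTerm Y) : Congr R (inv (inv s)) s
  | mul_inv_rev (s t : FTerm Y) : Congr R (inv (mul s t)) (mul (inv t) (inv s))
  | mul_inv_mul (s : FTerm Y) : Congr R (mul (mul s (inv s)) s) s
  | idem_comm (s t : FTerm Y) :
      Congr R (mul (mul s (inv s)) (mul t (inv t))) (mul (mul t (inv t)) (mul s (inv s)))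
  | le_maxOf (s : FTerm Y) : Congr R (mul (mul s (inv s)) (maxOf s)) s
  | maxOf_idem_mul (s t : FTerm Y) : Congr R (maxOf (mul (mul s (inv s)) t)) (maxOf t)

/-- The congruence as a setoid. -/
def setoid {Y : Type*} (R : Set (FTerm Y × FTerm Y)) : Setoid (FTerm Y) :=
  ⟨Congr R, Congr.refl, Congr.symm, Congr.trans⟩

/-- Soundness: congruent terms take the same value in every `F`-inverse monoid under every
assignment that satisfies the relations in `R`. -/
theorem Congr.eval_eq {Y S : Type*} [FInverseMonoid S] {R : Set (FTerm Y × FTerm Y)} (φ : Y → S)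
    (hR : ∀ p ∈ R, eval φ p.1 = eval φ p.2) {s t : FTerm Y} (h : Congr R s t) :
    eval φ s = eval φ t := by
  have hself : ∀ a : S, InverseMonoid.NatLE a (FInverseMonoid.maxOf a) := fun a =>
    FInverseMonoid.le_maxOf a a ⟨a, InverseMonoid.NatLE.refl a, InverseMonoid.NatLE.refl a⟩
  induction h with
  | of h => exact hR _ h
  | refl => rfl
  | symm _ ih => exact ih.symm
  | trans _ _ ih1 ih2 => exact ih1.trans ih2
  | mul_congr _ _ ih1 ih2 => simp only [eval, ih1, ih2]
  | inv_congr _ ih => simp only [eval, ih]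
  | maxOf_congr _ ih => simp only [eval, ih]
  | mul_assoc => exact _root_.mul_assoc _ _ _
  | one_mul => exact _root_.one_mul _
  | mul_one => exact _root_.mul_one _
  | inv_inv => exact InverseMonoid.double_inv _
  | mul_inv_rev => exact InverseMonoid.mul_inv_rev' _ _
  | mul_inv_mul => exact InverseMonoid.mul_inv_mul _
  | idem_comm =>
    exact InverseMonoid.idem_comm (InverseMonoid.mul_inv_idem _) (InverseMonoid.mul_inv_idem _)
  | le_maxOf => exact (hself _).eq_mul.symm
  | maxOf_idem_mul s t =>
    simp only [eval]
    generalize eval φ s = a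
    generalize eval φ t = b
    have hle : InverseMonoid.NatLE (a * a⁻¹ * b) b := ⟨_, InverseMonoid.mul_inv_idem a, rfl⟩
    obtain ⟨c, hc1, hc2⟩ := FInverseMonoid.sigma_maxOf (a * a⁻¹ * b)
    apply InverseMonoid.NatLE.antisymm
    · exact FInverseMonoid.le_maxOf _ _ ⟨c, hc1.trans hle, hc2⟩
    · exact FInverseMonoid.le_maxOf _ _ ⟨_, InverseMonoid.NatLE.refl _, hle.trans (hself b)⟩

end FTerm

/-- The `F`-inverse monoid `FInv⟨Y | R⟩` given by generators `Y` and relations `R`. -/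
def FInv {Y : Type*} (R : Set (FTerm Y × FTerm Y)) : Type _ := Quotient (FTerm.setoid R)

namespace FInv

variable {Y : Type*} (R : Set (FTerm Y × FTerm Y))

/-- The element of `FInv⟨Y | R⟩` represented by a term. -/
def mk (t : FTerm Y) : FInv R := Quotient.mk (FTerm.setoid R) t

instance : Monoid (FInv R) where
  mul := Quotient.map₂ FTerm.mul fun _ _ h _ _ h' => FTerm.Congr.mul_congr h h'
  one := mk R FTerm.one
  mul_assoc := by
    rintro ⟨a⟩ ⟨b⟩ ⟨c⟩; exact Quotient.sound (FTerm.Congr.mul_assoc a b c)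
  one_mul := by rintro ⟨a⟩; exact Quotient.sound (FTerm.Congr.one_mul a)
  mul_one := by rintro ⟨a⟩; exact Quotient.sound (FTerm.Congr.mul_one a)

instance : Inv (FInv R) where
  inv := Quotient.map FTerm.inv fun _ _ h => FTerm.Congr.inv_congr h

theorem double_inv (a : FInv R) : a⁻¹⁻¹ = a := by
  obtain ⟨a⟩ := a; exact Quotient.sound (FTerm.Congr.inv_inv a)

theorem mul_inv_mul (a : FInv R) : a * a⁻¹ * a = a := by
  obtain ⟨a⟩ := a; exact Quotient.sound (FTerm.Congr.mul_inv_mul a)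

instance : InverseMonoid (FInv R) where
  mul_inv_mul := mul_inv_mul R
  inv_mul_inv a := by
    have := mul_inv_mul R a⁻¹
    rwa [double_inv] at this
  inv_unique := by
    refine InverseMonoid.unique_of_equations (double_inv R) ?_ (mul_inv_mul R) ?_
    · rintro ⟨a⟩ ⟨b⟩; exact Quotient.sound (FTerm.Congr.mul_inv_rev a b)
    · rintro ⟨a⟩ ⟨b⟩; exact Quotient.sound (FTerm.Congr.idem_comm a b)

/-- The operation `ᵐ` on `FInv⟨Y | R⟩` induced by that on terms. -/
def maxOf : FInv R → FInv R :=
  Quotient.map FTerm.maxOf fun _ _ h => FTerm.Congr.maxOf_congr h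

theorem natLE_maxOf (a : FInv R) : InverseMonoid.NatLE a (maxOf R a) := by
  refine ⟨a * a⁻¹, InverseMonoid.mul_inv_idem a, ?_⟩
  obtain ⟨a⟩ := a
  exact (Quotient.sound (FTerm.Congr.le_maxOf a)).symm

theorem maxOf_eq_of_natLE {a b : FInv R} (h : InverseMonoid.NatLE a b) :
    maxOf R a = maxOf R b := by
  rw [h.eq_mul]
  obtain ⟨a⟩ := a
  obtain ⟨b⟩ := b
  exact Quotient.sound (FTerm.Congr.maxOf_idem_mul a b)

instance : FInverseMonoid (FInv R) where
  maxOf := maxOf R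
  sigma_maxOf a := ⟨a, InverseMonoid.NatLE.refl a, natLE_maxOf R a⟩
  le_maxOf a b := by
    rintro ⟨c, h1, h2⟩
    rw [← maxOf_eq_of_natLE R h1, maxOf_eq_of_natLE R h2]
    exact natLE_maxOf R b

end FInv

/-- An `F`-inverse monoid is finitely presented if it is isomorphic, in the signature
`(·, 1, ⁻¹, ᵐ)`, to `FInv⟨Y | R⟩` for a finite set `Y` and a finite set `R` of relations. -/
def FInverseMonoid.IsFinitelyPresented (S : Type*) [FInverseMonoid S] : Prop :=
  ∃ (Y : Type) (_ : Finite Y) (R : Set (FTerm Y × FTerm Y)) (_ : R.Finite) (e : FInv R ≃* S),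
    (∀ a : FInv R, e a⁻¹ = (e a)⁻¹) ∧
    (∀ a : FInv R, e (FInverseMonoid.maxOf a) = FInverseMonoid.maxOf (e a))

/-- Words in `(X ∪ X⁻¹)*`; the letter `(x, true)` stands for `x` and `(x, false)` for `x⁻¹`. -/
abbrev InvWord (X : Type*) := FreeMonoid (X × Bool)

/-- The formal inverse of a word. -/
def InvWord.inv {X : Type*} (w : InvWord X) : InvWord X :=
  FreeMonoid.ofList (FreeGroup.invRev w.toList)

namespace FIM

/-- The defining relations of the free inverse monoid. -/
inductive Rel (X : Type*) : InvWord X → InvWord X → Prop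
  | mul_inv_mul (w : InvWord X) : Rel X (w * w.inv * w) w
  | idem_comm (w v : InvWord X) : Rel X ((w * w.inv) * (v * v.inv)) ((v * v.inv) * (w * w.inv))

/-- The Vagner congruence on `(X ∪ X⁻¹)*`. -/
def vagner (X : Type*) : Con (InvWord X) := conGen (Rel X)

end FIM

/-- The free inverse monoid on `X`. -/
def FIM (X : Type*) : Type _ := (FIM.vagner X).Quotient

namespace FIM

variable {X : Type*}

instance : Monoid (FIM X) := inferInstanceAs (Monoid (FIM.vagner X).Quotient)

/-- The element of the free inverse monoid represented by a word. -/
def mk : InvWord X →* FIM X := (FIM.vagner X).mk'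

theorem mk_surjective : Function.Surjective (mk (X := X)) := Con.mk'_surjective

theorem mk_eq {w v : InvWord X} : mk w = mk v ↔ vagner X w v := (vagner X).eq

theorem inv_mul_word (w v : InvWord X) : (w * v).inv = v.inv * w.inv := by
  apply FreeMonoid.toList.injective
  simp [InvWord.inv, FreeGroup.invRev, FreeMonoid.toList_mul]

theorem inv_inv_word (w : InvWord X) : w.inv.inv = w := by
  apply FreeMonoid.toList.injective
  simp [InvWord.inv, FreeGroup.invRev_invRev]

theorem vagner_inv {w v : InvWord X} (h : vagner X w v) : vagner X w.inv v.inv := by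
  replace h : ConGen.Rel (Rel X) w v := h
  induction h with
  | of _ _ h =>
    cases h with
    | mul_inv_mul w =>
      have this (a : InvWord X) := ConGen.Rel.of _ _ (Rel.mul_inv_mul a.inv)
      simp only [inv_mul_word, inv_inv_word, ← mul_assoc] at this ⊢
      exact this _
    | idem_comm w v =>
      have := ConGen.Rel.of _ _ (Rel.idem_comm v w)
      simp only [inv_mul_word, inv_inv_word] at this ⊢
      exact this
  | refl => exact (vagner X).refl _
  | symm _ ih => exact (vagner X).symm ih
  | trans _ _ ih1 ih2 => exact (vagner X).trans ih1 ih2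
  | mul _ _ ih1 ih2 =>
    rw [inv_mul_word, inv_mul_word]
    exact (vagner X).mul ih2 ih1

instance : Inv (FIM X) where
  inv := Quotient.map InvWord.inv fun _ _ h => vagner_inv h

theorem mk_inv (w : InvWord X) : mk w.inv = (mk w)⁻¹ := rfl

theorem double_inv (a : FIM X) : a⁻¹⁻¹ = a := by
  obtain ⟨w, rfl⟩ := mk_surjective a
  rw [← mk_inv, ← mk_inv, inv_inv_word]

theorem mul_inv_mul (a : FIM X) : a * a⁻¹ * a = a := by
  obtain ⟨w, rfl⟩ := mk_surjective a
  rw [← mk_inv, ← map_mul, ← map_mul, mk_eq]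
  exact ConGen.Rel.of _ _ (Rel.mul_inv_mul w)

instance : InverseMonoid (FIM X) where
  mul_inv_mul := mul_inv_mul
  inv_mul_inv a := by
    have := mul_inv_mul a⁻¹
    rwa [double_inv] at this
  inv_unique := by
    refine InverseMonoid.unique_of_equations double_inv ?_ mul_inv_mul ?_
    · intro a b
      obtain ⟨w, rfl⟩ := mk_surjective a
      obtain ⟨v, rfl⟩ := mk_surjective b
      rw [← map_mul, ← mk_inv, ← mk_inv, ← mk_inv, ← map_mul, inv_mul_word]
    · intro a b
      obtain ⟨w, rfl⟩ := mk_surjective a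
      obtain ⟨v, rfl⟩ := mk_surjective b
      simp only [← mk_inv, ← map_mul]
      rw [mk_eq]
      exact ConGen.Rel.of _ _ (Rel.idem_comm w v)

theorem freeGroup_mk_eq {w v : InvWord X} (h : vagner X w v) :
    FreeGroup.mk w.toList = FreeGroup.mk v.toList := by
  replace h : ConGen.Rel (Rel X) w v := h
  have hm : ∀ a b : InvWord X,
      FreeGroup.mk (a * b).toList = FreeGroup.mk a.toList * FreeGroup.mk b.toList := by
    intro a b; rw [FreeMonoid.toList_mul, FreeGroup.mul_mk]
  have hi : ∀ a : InvWord X, FreeGroup.mk a.inv.toList = (FreeGroup.mk a.toList)⁻¹ := by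
    intro a; rw [FreeGroup.inv_mk]; rfl
  induction h with
  | of _ _ h => cases h <;> simp only [hm, hi] <;> group
  | refl => rfl
  | symm _ ih => exact ih.symm
  | trans _ _ ih1 ih2 => exact ih1.trans ih2
  | mul _ _ ih1 ih2 => rw [hm, hm, ih1, ih2]

/-- The canonical map from the free inverse monoid to the free group. -/
def toFreeGroup : FIM X → FreeGroup X :=
  Quotient.lift (fun w : InvWord X => FreeGroup.mk w.toList) fun _ _ h => freeGroup_mk_eq h

theorem toFreeGroup_mk (w : InvWord X) : toFreeGroup (mk w) = FreeGroup.mk w.toList := rfl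

theorem toFreeGroup_mul (a b : FIM X) : toFreeGroup (a * b) = toFreeGroup a * toFreeGroup b := by
  obtain ⟨w, rfl⟩ := mk_surjective a
  obtain ⟨v, rfl⟩ := mk_surjective b
  rw [← map_mul]
  simp only [toFreeGroup_mk]
  rw [FreeMonoid.toList_mul, FreeGroup.mul_mk]

theorem toFreeGroup_eq_of_natLE {a b : FIM X} (h : InverseMonoid.NatLE a b) :
    toFreeGroup a = toFreeGroup b := by
  obtain ⟨e, he, rfl⟩ := h
  have h1 : toFreeGroup e * toFreeGroup e = toFreeGroup e := by rw [← toFreeGroup_mul, he.eq]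
  rw [toFreeGroup_mul, mul_eq_left.mp h1, one_mul]

open Classical in
/-- The element of the free inverse monoid represented by the freely reduced word `red(w)` of any
word `w` that represents `a`. -/
noncomputable def red (a : FIM X) : FIM X := mk (FreeMonoid.ofList (toFreeGroup a).toWord)

theorem natLE_of_red {L L' : List (X × Bool)} (h : FreeGroup.Red L L') :
    InverseMonoid.NatLE (mk (FreeMonoid.ofList L)) (mk (FreeMonoid.ofList L')) := by
  induction h with
  | refl => exact InverseMonoid.NatLE.refl _
  | tail _ h ih =>
    refine ih.trans ?_
    cases h with
    | @not L₁ L₂ x b =>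
      have h1 : FreeMonoid.ofList (L₁ ++ (x, b) :: (x, !b) :: L₂) =
          FreeMonoid.ofList L₁ * (FreeMonoid.of (x, b) * InvWord.inv (FreeMonoid.of (x, b))) *
            FreeMonoid.ofList L₂ := by
        apply FreeMonoid.toList.injective
        simp [FreeMonoid.toList_mul, InvWord.inv, FreeGroup.invRev]
      rw [h1, FreeMonoid.ofList_append]
      simp only [map_mul, mk_inv]
      exact InverseMonoid.natLE_insert_idem _ _ (InverseMonoid.mul_inv_idem _)

theorem natLE_red (a : FIM X) : InverseMonoid.NatLE a (red a) := by
  classical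
  obtain ⟨w, rfl⟩ := mk_surjective a
  have := natLE_of_red (FreeGroup.reduce.red (L := w.toList))
  rw [FreeMonoid.ofList_toList] at this
  rw [red, toFreeGroup_mk, FreeGroup.toWord_mk]
  convert this

/-- The free inverse monoid is `F`-inverse, with `wᵐ = red(w)`. -/
noncomputable instance : FInverseMonoid (FIM X) where
  maxOf := red
  sigma_maxOf a := ⟨a, InverseMonoid.NatLE.refl a, natLE_red a⟩
  le_maxOf a b := by
    rintro ⟨c, h1, h2⟩
    have : red a = red b := by
      rw [red, red, ← toFreeGroup_eq_of_natLE h1, toFreeGroup_eq_of_natLE h2]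
    rw [this]
    exact natLE_red b

end FIM

/-!
Let `c` be a closure operator on the subsets of a group `G` that commutes with left translations.
The pairs `(A, g)` with `A` closed and `1, g ∈ A` form an `F`-inverse monoid, in which the
`σ`-class of `(A, g)` has the greatest element `(c {1, g}, g)`. For `G` the free group on `X`, the
free inverse monoid maps to it by sending a word `w` to the closure of its Munn tree (the set of
its prefixes), paired with its value in `G`.

Let `cₙ` be the closure operator whose closed sets contain the geodesic between any two of their
points at distance at most `n` in the Cayley tree. The resulting map `fₙ` commutes with `ᵐ` at the
elements whose reduced word has length at most `n`, but not at `x ^ (n + 2)`, because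
`{1, x ^ (n + 2)}` is already closed. If `FIM(X)` were presented by finitely many relations, then
for large `n` these relations, in which `ᵐ` occurs only finitely often, would also hold in the
image of `fₙ`. This yields a homomorphism that commutes with `ᵐ` everywhere and agrees with `fₙ`
at `x`, hence at `x ^ (n + 2) = (x ^ (n + 2))ᵐ`, a contradiction.
-/

/-! ### Finitely related `F`-inverse monoids -/

namespace InverseMonoid

variable {S T : Type*} [InverseMonoid S]

theorem map_inv [InverseMonoid T] (f : S →* T) (a : S) : f a⁻¹ = (f a)⁻¹ := by
  refine inv_unique _ _ ?_ ?_
  · rw [← map_mul, ← map_mul, mul_inv_mul]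
  · rw [← map_mul, ← map_mul, inv_mul_inv]

theorem NatLE.map_eq {G : Type*} [Group G] (f : S →* G) {a b : S} (h : NatLE a b) :
    f a = f b := by
  obtain ⟨e, he, rfl⟩ := h
  have hfe : f e = 1 := mul_eq_left.mp (by rw [← map_mul, he.eq])
  rw [map_mul, hfe, one_mul]

end InverseMonoid

namespace FInverseMonoid

/-- A map between `F`-inverse monoids that commutes with the operation `ᵐ`. Homomorphisms of
`F`-inverse monoids are encoded as monoid homomorphisms with this property, since monoid
homomorphisms between inverse monoids commute with inversion. -/
def PreservesMaxOf {S T : Type*} [FInverseMonoid S] [FInverseMonoid T] (f : S → T) : Prop :=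
  ∀ a, f (maxOf a) = maxOf (f a)

/-- An `F`-inverse monoid is finitely related if it is isomorphic to `FInv⟨Y | R⟩` for some set
`Y`, possibly infinite, and a finite set `R` of relations. -/
def IsFinitelyRelated.{v, u} (S : Type u) [FInverseMonoid S] : Prop :=
  ∃ (Y : Type v) (R : Set (FTerm Y × FTerm Y)) (e : FInv R ≃* S), R.Finite ∧ PreservesMaxOf e

theorem IsFinitelyPresented.isFinitelyRelated {S : Type*} [FInverseMonoid S]
    (h : IsFinitelyPresented S) : IsFinitelyRelated.{0} S := by
  obtain ⟨Y, -, R, hR, e, -, he⟩ := h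
  exact ⟨Y, R, e, hR, he⟩

end FInverseMonoid

open FInverseMonoid (maxOf PreservesMaxOf)

namespace FInv

variable {Y S : Type*} [FInverseMonoid S] {R : Set (FTerm Y × FTerm Y)}

theorem map_mk {f : FInv R →* S} (hf : PreservesMaxOf f) (t : FTerm Y) :
    f (mk R t) = t.eval fun y => f (mk R (.var y)) := by
  induction t with
  | var y => rfl
  | one => exact map_one f
  | mul s t hs ht => rw [FTerm.eval, ← hs, ← ht, ← map_mul]; rfl
  | inv t ht => rw [FTerm.eval, ← ht, ← InverseMonoid.map_inv]; rfl
  | maxOf t ht => rw [FTerm.eval, ← ht, ← hf]; rfl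

/-- The homomorphism from `FInv⟨Y | R⟩` induced by an assignment of the generators that satisfies
the relations in `R`. -/
def lift (φ : Y → S) (hφ : ∀ p ∈ R, p.1.eval φ = p.2.eval φ) : FInv R →* S where
  toFun := Quotient.lift (FTerm.eval φ) fun _ _ => FTerm.Congr.eval_eq φ hφ
  map_one' := rfl
  map_mul' := by rintro ⟨s⟩ ⟨t⟩; rfl

theorem preservesMaxOf_lift (φ : Y → S) (hφ : ∀ p ∈ R, p.1.eval φ = p.2.eval φ) :
    PreservesMaxOf (lift φ hφ) := by
  rintro ⟨t⟩; rfl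

end FInv

section Approximation

open Filter

variable {ι S Y : Type*} {l : Filter ι} {T : ι → Type*} [FInverseMonoid S]
  [∀ i, FInverseMonoid (T i)] {f : ∀ i, S →* T i}

theorem FTerm.eventually_eval_comp
    (hf : ∀ a, ∀ᶠ i in l, f i (FInverseMonoid.maxOf a) = FInverseMonoid.maxOf (f i a))
    (φ : Y → S) (t : FTerm Y) : ∀ᶠ i in l, t.eval (fun y => f i (φ y)) = f i (t.eval φ) := by
  induction t with
  | var y => exact .of_forall fun _ => rfl
  | one => exact .of_forall fun i => (map_one (f i)).symm
  | mul s t hs ht =>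
    filter_upwards [hs, ht] with i hs ht
    simp only [eval, hs, ht, map_mul]
  | inv t ht =>
    filter_upwards [ht] with i ht
    simp only [eval, ht, InverseMonoid.map_inv]
  | maxOf t ht =>
    filter_upwards [ht, hf (t.eval φ)] with i ht hi
    rw [eval, eval, ht, hi]

theorem FInverseMonoid.IsFinitelyRelated.eventually_exists_preservesMaxOf_eq
    (hS : IsFinitelyRelated S) (hf : ∀ a, ∀ᶠ i in l, f i (maxOf a) = maxOf (f i a)) (a : S) :
    ∀ᶠ i in l, ∃ g : S →* T i, PreservesMaxOf g ∧ g a = f i a := by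
  obtain ⟨Y, R, e, hR, he⟩ := hS
  let φ : Y → S := fun y => e (FInv.mk R (.var y))
  have e_mk (t : FTerm Y) : e (FInv.mk R t) = t.eval φ := FInv.map_mk (f := e.toMonoidHom) he t
  obtain ⟨t, ht⟩ : ∃ t, FInv.mk R t = e.symm a := Quotient.exists_rep _
  have relations_hold : ∀ᶠ i in l, ∀ p ∈ R,
      p.1.eval (fun y => f i (φ y)) = p.2.eval fun y => f i (φ y) := by
    refine (eventually_all_finite hR).mpr fun p hp => ?_
    have hφp : p.1.eval φ = p.2.eval φ := by
      rw [← e_mk, ← e_mk]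
      exact congrArg e (Quotient.sound (FTerm.Congr.of hp))
    filter_upwards [FTerm.eventually_eval_comp hf φ p.1, FTerm.eventually_eval_comp hf φ p.2]
      with i h₁ h₂
    rw [h₁, h₂, hφp]
  filter_upwards [relations_hold, FTerm.eventually_eval_comp hf φ t] with i hi hti
  refine ⟨(FInv.lift _ hi).comp e.symm.toMonoidHom, fun b => ?_, ?_⟩
  · obtain ⟨b, rfl⟩ := e.surjective b
    simpa [← he b] using FInv.preservesMaxOf_lift _ hi b
  · calc FInv.lift _ hi (e.symm a) = t.eval (fun y => f i (φ y)) := by rw [← ht]; rfl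
      _ = f i a := by rw [hti, ← e_mk, ht, e.apply_symm_apply]

end Approximation

/-! ### Expansions of a group by closed sets -/

open scoped Pointwise

/-- A closure operator on the subsets of a group that commutes with left translations (see
`EquivariantClosure.map_smul`), which is encoded as the invariance of its closed sets. -/
structure EquivariantClosure (G : Type*) [Group G] extends ClosureOperator (Set G) where
  isClosed_smul : ∀ (k : G) {A : Set G}, IsClosed A → IsClosed (k • A)

namespace EquivariantClosure

variable {G : Type*} [Group G]

instance : CoeFun (EquivariantClosure G) fun _ => Set G → Set G :=
  ⟨fun c => c.toClosureOperator⟩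

variable (c : EquivariantClosure G)

theorem closure_union_closure_left (A B : Set G) : c (c A ∪ B) = c (A ∪ B) :=
  c.closure_sup_closure_left A B

theorem closure_union_closure_right (A B : Set G) : c (A ∪ c B) = c (A ∪ B) :=
  c.closure_sup_closure_right A B

theorem map_smul (k : G) (A : Set G) : c (k • A) = k • c A := by
  apply Set.Subset.antisymm
  · exact ClosureOperator.closure_min (Set.smul_set_mono (c.le_closure A))
      (c.isClosed_smul k (c.isClosed_closure A))
  · rw [Set.smul_set_subset_iff_subset_inv_smul_set]
    refine ClosureOperator.closure_min ?_ (c.isClosed_smul _ (c.isClosed_closure _))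
    exact Set.smul_set_subset_iff_subset_inv_smul_set.mp (c.le_closure _)

end EquivariantClosure

/-- The expansion of a group by the closed sets of an equivariant closure operator: the pairs of
a closed set containing `1` and an element of it. Under the semidirect-type product
`(A, g) * (B, h) = (c (A ∪ g • B), g * h)` they form an `F`-inverse monoid. -/
@[ext]
structure ClosedExpansion {G : Type*} [Group G] (c : EquivariantClosure G) where
  carrier : Set G
  elem : G
  isClosed : c.IsClosed carrier
  one_mem : 1 ∈ carrier
  elem_mem : elem ∈ carrier

namespace ClosedExpansion

variable {G : Type*} [Group G] {c : EquivariantClosure G}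

theorem closure_carrier (a : ClosedExpansion c) : c a.carrier = a.carrier :=
  a.isClosed.closure_eq

instance : Mul (ClosedExpansion c) where
  mul a b :=
    { carrier := c (a.carrier ∪ a.elem • b.carrier)
      elem := a.elem * b.elem
      isClosed := c.isClosed_closure _
      one_mem := c.le_closure _ (.inl a.one_mem)
      elem_mem := c.le_closure _ (.inr (Set.smul_mem_smul_set b.elem_mem)) }

instance : One (ClosedExpansion c) where
  one :=
    { carrier := c {1}
      elem := 1
      isClosed := c.isClosed_closure _
      one_mem := c.le_closure _ rfl
      elem_mem := c.le_closure _ rfl }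

instance : Inv (ClosedExpansion c) where
  inv a :=
    { carrier := a.elem⁻¹ • a.carrier
      elem := a.elem⁻¹
      isClosed := c.isClosed_smul _ a.isClosed
      one_mem := Set.mem_inv_smul_set_iff.mpr (by simpa using a.elem_mem)
      elem_mem := Set.mem_inv_smul_set_iff.mpr (by simpa using a.one_mem) }

theorem mul_carrier (a b : ClosedExpansion c) :
    (a * b).carrier = c (a.carrier ∪ a.elem • b.carrier) := rfl

theorem mul_elem (a b : ClosedExpansion c) : (a * b).elem = a.elem * b.elem := rfl

theorem one_carrier : (1 : ClosedExpansion c).carrier = c {1} := rfl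

theorem one_elem : (1 : ClosedExpansion c).elem = 1 := rfl

theorem inv_carrier (a : ClosedExpansion c) : a⁻¹.carrier = a.elem⁻¹ • a.carrier := rfl

theorem inv_elem (a : ClosedExpansion c) : a⁻¹.elem = a.elem⁻¹ := rfl

instance : Monoid (ClosedExpansion c) where
  mul_assoc a b d := by
    ext1
    · simp only [mul_carrier, mul_elem, ← c.map_smul, c.closure_union_closure_left,
        c.closure_union_closure_right, Set.smul_set_union, mul_smul, Set.union_assoc]
    · exact mul_assoc _ _ _
  one_mul a := by
    ext1
    · rw [mul_carrier, one_carrier, one_elem, one_smul, c.closure_union_closure_left,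
        Set.union_eq_right.mpr (Set.singleton_subset_iff.mpr a.one_mem), closure_carrier]
    · exact one_mul _
  mul_one a := by
    ext1
    · rw [mul_carrier, one_carrier, ← c.map_smul, c.closure_union_closure_right,
        Set.smul_set_singleton, smul_eq_mul, mul_one,
        Set.union_eq_left.mpr (Set.singleton_subset_iff.mpr a.elem_mem), closure_carrier]
    · exact mul_one _

theorem inv_inv_eq (a : ClosedExpansion c) : a⁻¹⁻¹ = a := by
  ext1
  · simp only [inv_carrier, inv_elem, inv_inv, smul_inv_smul]
  · exact inv_inv _

theorem mul_inv_rev_eq (a b : ClosedExpansion c) : (a * b)⁻¹ = b⁻¹ * a⁻¹ := by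
  ext1
  · simp only [inv_carrier, inv_elem, mul_carrier, mul_elem, ← c.map_smul, Set.smul_set_union,
      mul_inv_rev, mul_smul, inv_smul_smul, Set.union_comm]
  · exact mul_inv_rev _ _

theorem mul_inv_carrier (a : ClosedExpansion c) : (a * a⁻¹).carrier = a.carrier := by
  rw [mul_carrier, inv_carrier, smul_inv_smul, Set.union_self, closure_carrier]

theorem mul_inv_elem (a : ClosedExpansion c) : (a * a⁻¹).elem = 1 := mul_inv_cancel _

theorem mul_inv_mul_eq_left {a b : ClosedExpansion c} (hcarrier : b.carrier ⊆ a.carrier)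
    (helem : a.elem = b.elem) : a * a⁻¹ * b = a := by
  ext1
  · rw [mul_carrier, mul_inv_carrier, mul_inv_elem, one_smul, Set.union_eq_left.mpr hcarrier,
      closure_carrier]
  · rw [mul_elem, mul_inv_elem, one_mul, helem]

theorem mul_comm_of_elem_eq_one {a b : ClosedExpansion c} (ha : a.elem = 1) (hb : b.elem = 1) :
    a * b = b * a := by
  ext1
  · simp only [mul_carrier, ha, hb, one_smul, Set.union_comm]
  · simp only [mul_elem, ha, hb]

theorem mul_inv_mul_self (a : ClosedExpansion c) : a * a⁻¹ * a = a :=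
  mul_inv_mul_eq_left subset_rfl rfl

instance : InverseMonoid (ClosedExpansion c) where
  mul_inv_mul := mul_inv_mul_self
  inv_mul_inv a := by simpa only [inv_inv_eq] using mul_inv_mul_self a⁻¹
  inv_unique := InverseMonoid.unique_of_equations inv_inv_eq mul_inv_rev_eq mul_inv_mul_self
    fun a b => mul_comm_of_elem_eq_one (mul_inv_elem a) (mul_inv_elem b)

/-- The projection of the expansion to the group. -/
def elemHom (c : EquivariantClosure G) : ClosedExpansion c →* G where
  toFun := elem
  map_one' := rfl
  map_mul' _ _ := rfl

/-- The pair `(c {1, g}, g)`, which is the greatest element of the expansion over `g`. -/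
def greatest (c : EquivariantClosure G) (g : G) : ClosedExpansion c where
  carrier := c {1, g}
  elem := g
  isClosed := c.isClosed_closure _
  one_mem := c.le_closure _ (.inl rfl)
  elem_mem := c.le_closure _ (.inr rfl)

theorem greatest_carrier (g : G) : (greatest c g).carrier = c {1, g} := rfl

theorem greatest_elem (g : G) : (greatest c g).elem = g := rfl

theorem natLE_greatest (a : ClosedExpansion c) : InverseMonoid.NatLE a (greatest c a.elem) := by
  have hsub : (greatest c a.elem).carrier ⊆ a.carrier :=
    ClosureOperator.closure_min (Set.pair_subset a.one_mem a.elem_mem) a.isClosed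
  exact ⟨a * a⁻¹, InverseMonoid.mul_inv_idem a, (mul_inv_mul_eq_left hsub rfl).symm⟩

instance : FInverseMonoid (ClosedExpansion c) where
  maxOf a := greatest c a.elem
  sigma_maxOf a := ⟨a, .refl a, natLE_greatest a⟩
  le_maxOf a b := by
    rintro ⟨d, hda, hdb⟩
    have helem : a.elem = b.elem := (hda.map_eq (elemHom c)).symm.trans (hdb.map_eq (elemHom c))
    exact helem ▸ natLE_greatest b

theorem maxOf_eq_greatest (a : ClosedExpansion c) : maxOf a = greatest c a.elem := rfl

theorem greatest_inv (g : G) : greatest c g⁻¹ = (greatest c g)⁻¹ := by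
  ext1
  · rw [inv_carrier, greatest_carrier, greatest_carrier, greatest_elem, ← c.map_smul,
      Set.smul_set_insert, Set.smul_set_singleton, smul_eq_mul, smul_eq_mul, mul_one,
      inv_mul_cancel, Set.pair_comm]
  · rfl

end ClosedExpansion

namespace FIM

variable {X : Type*}

/-! ### The free inverse monoid -/

section Lift

variable {S : Type*} [InverseMonoid S]

theorem freeMonoid_lift_inv {f : X × Bool → S} (hf : ∀ x b, f (x, !b) = (f (x, b))⁻¹)
    (w : InvWord X) : FreeMonoid.lift f w.inv = (FreeMonoid.lift f w)⁻¹ := by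
  induction w using FreeMonoid.inductionOn' with
  | one =>
    change FreeMonoid.lift f 1 = _
    rw [map_one, InverseMonoid.idem_inv (one_mul 1)]
  | of_mul p w ih =>
    have inv_of : InvWord.inv (FreeMonoid.of p) = FreeMonoid.of (p.1, !p.2) := rfl
    rw [inv_mul_word, map_mul, map_mul, ih, InverseMonoid.mul_inv_rev', inv_of,
      FreeMonoid.lift_eval_of, FreeMonoid.lift_eval_of, hf]

/-- The homomorphism from the free inverse monoid induced by an assignment of the letters. -/
def lift (f : X × Bool → S) (hf : ∀ x b, f (x, !b) = (f (x, b))⁻¹) : FIM X →* S :=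
  (vagner X).lift (FreeMonoid.lift f) <| Con.conGen_le.mpr fun w v h => by
    rw [Con.ker_rel]
    cases h with
    | mul_inv_mul w =>
      simp only [map_mul, freeMonoid_lift_inv hf, InverseMonoid.mul_inv_mul]
    | idem_comm w v =>
      simp only [map_mul, freeMonoid_lift_inv hf]
      exact InverseMonoid.idem_comm (InverseMonoid.mul_inv_idem _) (InverseMonoid.mul_inv_idem _)

end Lift

theorem maxOf_eq_mk_toWord [DecidableEq X] (a : FIM X) :
    maxOf a = mk (FreeMonoid.ofList (toFreeGroup a).toWord) := by
  change red a = _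
  rw [red]
  congr!

theorem toFreeGroup_maxOf (a : FIM X) : toFreeGroup (maxOf a) = toFreeGroup a :=
  (toFreeGroup_eq_of_natLE (natLE_red a)).symm

theorem toFreeGroup_mk_of_pow (x : X) (n : ℕ) :
    toFreeGroup (mk (FreeMonoid.of (x, true)) ^ n) = FreeGroup.of x ^ n := by
  induction n with
  | zero => rfl
  | succ n ih => rw [pow_succ, pow_succ, toFreeGroup_mul, ih]; rfl

theorem mk_ofList_replicate (p : X × Bool) (n : ℕ) :
    mk (FreeMonoid.ofList (List.replicate n p)) = mk (FreeMonoid.of p) ^ n := by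
  induction n with
  | zero => rfl
  | succ n ih =>
    rw [List.replicate_succ, FreeMonoid.ofList_cons, map_mul, ih, pow_succ']

theorem maxOf_mk_of_pow (x : X) (n : ℕ) :
    maxOf (mk (FreeMonoid.of (x, true)) ^ n) = mk (FreeMonoid.of (x, true)) ^ n := by
  classical
  rw [maxOf_eq_mk_toWord, toFreeGroup_mk_of_pow, FreeGroup.toWord_of_pow, mk_ofList_replicate]

/-- The vertex set of the Munn tree of a word: the values of its prefixes in the free group. -/
def munnTree (w : List (X × Bool)) : Set (FreeGroup X) :=
  FreeGroup.mk '' {u | u <+: w}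

theorem munnTree_nil : munnTree ([] : List (X × Bool)) = {1} := by
  simp [munnTree, FreeGroup.one_eq_mk]

theorem munnTree_cons (p : X × Bool) (w : List (X × Bool)) :
    munnTree (p :: w) = insert 1 (FreeGroup.mk [p] • munnTree w) := by
  ext g
  simp only [munnTree, List.prefix_cons_iff, Set.mem_insert_iff, Set.mem_smul_set, Set.mem_image,
    Set.mem_ofPred_eq]
  constructor
  · rintro ⟨_, rfl | ⟨u, rfl, hu⟩, rfl⟩
    · exact .inl rfl
    · exact .inr ⟨_, ⟨u, hu, rfl⟩, FreeGroup.mul_mk⟩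
  · rintro (rfl | ⟨_, ⟨u, hu, rfl⟩, rfl⟩)
    · exact ⟨[], .inl rfl, rfl⟩
    · exact ⟨p :: u, .inr ⟨u, rfl, hu⟩, (FreeGroup.mul_mk (L₁ := [p])).symm⟩

theorem one_mem_munnTree (w : List (X × Bool)) : 1 ∈ munnTree w :=
  ⟨[], List.nil_prefix, rfl⟩

theorem mk_mem_munnTree (w : List (X × Bool)) : FreeGroup.mk w ∈ munnTree w :=
  ⟨w, List.prefix_rfl, rfl⟩

section ToExpansion

variable (c : EquivariantClosure (FreeGroup X))

/-- The homomorphism from the free inverse monoid to an expansion of the free group that sends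
each letter `p` to `(c {1, p}, p)`. -/
def toExpansion : FIM X →* ClosedExpansion c :=
  lift (fun p => ClosedExpansion.greatest c (FreeGroup.mk [p])) fun x b => by
    rw [← ClosedExpansion.greatest_inv, FreeGroup.inv_mk]
    rfl

theorem toExpansion_elem (a : FIM X) : (toExpansion c a).elem = toFreeGroup a := by
  obtain ⟨w, rfl⟩ := mk_surjective a
  induction w using FreeMonoid.inductionOn' with
  | one => rfl
  | of_mul p w ih =>
    rw [map_mul, map_mul, ClosedExpansion.mul_elem, ih, toFreeGroup_mul]
    rfl

theorem toExpansion_mk_carrier (w : InvWord X) :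
    (toExpansion c (mk w)).carrier = c (munnTree w.toList) := by
  induction w using FreeMonoid.inductionOn' with
  | one => exact congrArg c munnTree_nil.symm
  | of_mul p w ih =>
    let g := FreeGroup.mk [p]
    calc (toExpansion c (mk (FreeMonoid.of p * w))).carrier
        = c (c {1, g} ∪ g • c (munnTree w.toList)) := by
          rw [map_mul, map_mul, ClosedExpansion.mul_carrier, ih]; rfl
      _ = c (insert 1 (insert g (g • munnTree w.toList))) := by
          rw [← c.map_smul, c.closure_union_closure_left, c.closure_union_closure_right,
            Set.insert_union, Set.singleton_union]
      _ = c (munnTree (p :: w.toList)) := by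
          have hg : g ∈ g • munnTree w.toList :=
            ⟨1, one_mem_munnTree _, mul_one g⟩
          rw [Set.insert_eq_of_mem hg, munnTree_cons]

theorem toExpansion_maxOf_iff [DecidableEq X] (a : FIM X) :
    toExpansion c (maxOf a) = maxOf (toExpansion c a) ↔
      munnTree (toFreeGroup a).toWord ⊆ c {1, toFreeGroup a} := by
  have hcarrier : (toExpansion c (maxOf a)).carrier = c (munnTree (toFreeGroup a).toWord) := by
    rw [maxOf_eq_mk_toWord, toExpansion_mk_carrier, FreeMonoid.toList_ofList]
  have hpair : {1, toFreeGroup a} ⊆ munnTree (toFreeGroup a).toWord := by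
    refine Set.pair_subset (one_mem_munnTree _) ?_
    simpa only [FreeGroup.mk_toWord] using mk_mem_munnTree (toFreeGroup a).toWord
  rw [ClosedExpansion.maxOf_eq_greatest, toExpansion_elem, ClosedExpansion.ext_iff, hcarrier,
    toExpansion_elem, toFreeGroup_maxOf, ClosedExpansion.greatest_carrier,
    ClosedExpansion.greatest_elem, and_iff_left rfl, c.le_closure_iff]
  exact ⟨fun h => h.le, fun h => h.antisymm (c.monotone hpair)⟩

end ToExpansion

/-! ### Local convexity in the Cayley tree -/

variable [DecidableEq X]

/-- A set of vertices of the Cayley tree of the free group is `n`-convex if it contains the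
geodesic between any two of its vertices `g` and `g * h` at distance at most `n`; this geodesic is
the translate by `g` of the Munn tree of the reduced word of `h`. -/
def IsConvexUpTo (n : ℕ) (A : Set (FreeGroup X)) : Prop :=
  ∀ g h, h.norm ≤ n → g ∈ A → g * h ∈ A → g • munnTree h.toWord ⊆ A

theorem IsConvexUpTo.smul {n : ℕ} {A : Set (FreeGroup X)} (hA : IsConvexUpTo n A)
    (k : FreeGroup X) : IsConvexUpTo n (k • A) := by
  intro g h hn hg hgh
  rw [Set.mem_smul_set_iff_inv_smul_mem, smul_eq_mul] at hg hgh
  rw [← Set.smul_set_subset_smul_set_iff (a := k⁻¹), inv_smul_smul, smul_smul]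
  exact hA _ h hn hg (by rwa [mul_assoc])

theorem isConvexUpTo_sInter {n : ℕ} {𝒜 : Set (Set (FreeGroup X))}
    (h𝒜 : ∀ A ∈ 𝒜, IsConvexUpTo n A) : IsConvexUpTo n (⋂₀ 𝒜) :=
  fun g h hn hg hgh => Set.subset_sInter fun A hA => h𝒜 A hA g h hn (hg A hA) (hgh A hA)

theorem isConvexUpTo_pair {n : ℕ} {g : FreeGroup X} (hg : n < g.norm) :
    IsConvexUpTo n {1, g} := by
  intro k h hn hk hkh
  have h_one : h = 1 := by
    rcases hk with rfl | rfl <;> rcases hkh with hkh | hkh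
    · rwa [one_mul] at hkh
    · rw [one_mul, Set.mem_singleton_iff] at hkh
      exact absurd hg (hkh ▸ hn).not_gt
    · rw [mul_eq_one_iff_inv_eq] at hkh
      rw [← hkh, FreeGroup.norm_inv_eq] at hn
      exact absurd hg hn.not_gt
    · exact mul_eq_left.mp hkh
  rw [h_one, FreeGroup.toWord_one, munnTree_nil, Set.smul_set_singleton, smul_eq_mul, mul_one]
  exact Set.singleton_subset_iff.mpr hk

/-- The closure operator whose closed sets are the `n`-convex sets. -/
def convexClosure (X : Type*) [DecidableEq X] (n : ℕ) : EquivariantClosure (FreeGroup X) where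
  toClosureOperator := .ofCompletePred (IsConvexUpTo n) fun _ => isConvexUpTo_sInter
  isClosed_smul k _ hA := hA.smul k

theorem munnTree_toWord_subset_convexClosure {n : ℕ} {g : FreeGroup X} (hg : g.norm ≤ n) :
    munnTree g.toWord ⊆ convexClosure X n {1, g} := by
  have hconvex : IsConvexUpTo n (convexClosure X n {1, g}) := (convexClosure X n).isClosed_closure _
  have hpair : {1, g} ⊆ convexClosure X n {1, g} := (convexClosure X n).le_closure _
  have hg' : 1 * g ∈ convexClosure X n {1, g} := by rw [one_mul]; exact hpair (.inr rfl)
  simpa only [one_smul] using hconvex 1 g hg (hpair (.inl rfl)) hg'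

theorem eventually_toExpansion_maxOf (a : FIM X) : ∀ᶠ n in Filter.atTop,
    toExpansion (convexClosure X n) (maxOf a) = maxOf (toExpansion (convexClosure X n) a) := by
  filter_upwards [Filter.eventually_ge_atTop (toFreeGroup a).norm] with n hn
  exact (toExpansion_maxOf_iff _ a).mpr (munnTree_toWord_subset_convexClosure hn)

theorem toExpansion_maxOf_pow_ne (x : X) (n : ℕ) :
    toExpansion (convexClosure X n) (maxOf (mk (FreeMonoid.of (x, true)) ^ (n + 2))) ≠
      maxOf (toExpansion (convexClosure X n) (mk (FreeMonoid.of (x, true)) ^ (n + 2))) := by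
  rw [Ne, toExpansion_maxOf_iff, toFreeGroup_mk_of_pow]
  intro hsub
  have hclosed : (convexClosure X n).IsClosed {1, FreeGroup.of x ^ (n + 2)} :=
    isConvexUpTo_pair (by rw [FreeGroup.norm_of_pow]; omega)
  have hx : FreeGroup.of x ∈ munnTree (FreeGroup.of x ^ (n + 2)).toWord := by
    rw [FreeGroup.toWord_of_pow, List.replicate_succ]
    exact ⟨[(x, true)], by simp, rfl⟩
  rcases hclosed.closure_eq ▸ hsub hx with h | h
  · exact FreeGroup.of_ne_one x h
  · have hnorm := congrArg FreeGroup.norm (Set.mem_singleton_iff.mp h)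
    rw [FreeGroup.norm_of, FreeGroup.norm_of_pow] at hnorm
    omega

end FIM

theorem mainTheorem6_general.{v, u} (X : Type u) [Nonempty X] :
    ¬ FInverseMonoid.IsFinitelyRelated.{v} (FIM X) := by
  classical
  intro hX
  obtain ⟨x⟩ := ‹Nonempty X›
  let a : FIM X := FIM.mk (FreeMonoid.of (x, true))
  let f (n : ℕ) := FIM.toExpansion (FIM.convexClosure X n)
  obtain ⟨n, g, hg, hga⟩ :=
    (hX.eventually_exists_preservesMaxOf_eq (f := f) FIM.eventually_toExpansion_maxOf a).exists
  have maxOf_pow : maxOf (a ^ (n + 2)) = a ^ (n + 2) := FIM.maxOf_mk_of_pow x (n + 2)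
  have agree : g (a ^ (n + 2)) = f n (a ^ (n + 2)) := by rw [map_pow, map_pow, hga]
  apply FIM.toExpansion_maxOf_pow_ne x n
  calc f n (maxOf (a ^ (n + 2))) = g (maxOf (a ^ (n + 2))) := by rw [maxOf_pow, agree]
    _ = maxOf (f n (a ^ (n + 2))) := by rw [hg, agree]

/-- The free inverse monoid on a nonempty set is not finitely presented as an `F`-inverse
monoid. -/
theorem mainTheorem6 (X : Type*) [Nonempty X] :
    ¬ FInverseMonoid.IsFinitelyPresented (FIM X) :=
  fun h => mainTheorem6_general X h.isFinitelyRelated
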